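/- Let $w$ be any real number. Put $d_0=2^{-1/4}$, $c_0=2$, $a_0=0$ and, for $n\ge 0$, $$d_{n+1}=\frac{1-\sqrt[4]{1-d_n^4}}{1+\sqrt[4]{1-d_n^4}},\qquad c_{n+1}=4c_n(1+d_{n+1})^{2w-2},$$ $$a_{n+1}=a_n(1+d_{n+1})^{2w+2}+\frac12\,c_{n+1}\,\frac{d_{n+1}}{1+d_{n+1}}\,(1-d_{n+1}^4).$$ Then $a_n$ converges to $$L=\frac{1}{\Gamma\left(\frac34\right)^{2w-2}\,\pi^{\frac32-\frac w2}},$$ and the convergence is quartic, in the following sense: $|a_{n+1}-L|=O\left(|a_n-L|^4\right)$ as $n\to\infty$ (with a constant that may depend on $w$), $a_n\ne L$ for all large $n$, and the number of correct digits is asymptotically multiplied by $4$ in each iteration, i.e. $\log|a_{n+1}-L|/\log|a_n-L|\to 4$. -/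

import Mathlib

open Filter Topology Asymptotics

/-- The real sequence `u` converges quartically to `L`: it tends to `L`, the error after one more
step is at most a constant times the fourth power of the current error, and the number
`-log |u n - L|` of correct digits (in any base) is asymptotically multiplied by exactly `4`
in each step. (The last limit forces the errors to be nonzero for all large `n`.) -/
def ConvergesQuartically (u : ℕ → ℝ) (L : ℝ) : Prop :=
  Tendsto u atTop (𝓝 L) ∧
  (fun n => u (n + 1) - L) =O[atTop] (fun n => (u n - L) ^ 4) ∧
  Tendsto (fun n => Real.log |u (n + 1) - L| / Real.log |u n - L|) atTop (𝓝 4)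

/-! The iteration samples theta constants at `t = 4 ^ n`, with nome `q = exp (-π t)`. Write θ for
θ₃. The quartic modular equation identifies `d n` with θ₂/θ₃ at `4 ^ n`, and 1 + d (n + 1) =
θ(4^n)/θ(4^(n+1)), so the powers in the recursions telescope: c n = 2·4^n (θ(1)/θ(4^n))^(2w-2) and,
with L = θ(1)^(2w-2)/π, a n = L (1 + 4·4^n (θ'/θ)(4^n)) / θ(4^n)^(2w+2). The increment of `a` is the
formula for (θ'/θ)(t) - 4(θ'/θ)(4t) at these points (`thetaNullLogDeriv_sub`). The start a 0 = 0 is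
θ'(1)/θ(1) = -1/4, from the inversion t ↦ 1/t.

As t → ∞, θ'/θ ~ -2πq and θ - 1 = O(q), so the error is asymptotic to a nonzero constant times 4^n
exp(-π 4^n), which gives all the quartic claims.

The Gamma form of L needs θ(1) = π^(1/4)/Γ(3/4). Doubling t is an arithmetic-geometric mean step on
(θ₃², θ₄²), so Gauss's integral at t = 1 equals its limit π; there θ₃⁴ = 2θ₄⁴, which makes it a Beta
integral. -/

/-- The theta constant `θ₃` as a function of `t`, with nome `q = exp (-π t)`. -/
noncomputable def thetaNull (t : ℝ) : ℝ := ∑' n : ℤ, Real.exp (-Real.pi * t * (n : ℝ) ^ 2)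

lemma summable_thetaNull {t : ℝ} (ht : 0 < t) :
    Summable fun n : ℤ => Real.exp (-Real.pi * t * (n : ℝ) ^ 2) := by
  have h := HurwitzKernelBounds.summable_f_int 0 0 ht
  refine h.congr fun n => ?_
  simp only [HurwitzKernelBounds.f_int, pow_zero, one_mul, add_zero]
  congr 1; ring

lemma thetaNull_inv {t : ℝ} (ht : 0 < t) :
    thetaNull t = t ^ (-(1 / 2) : ℝ) * thetaNull t⁻¹ := by
  unfold thetaNull
  rw [Real.tsum_exp_neg_mul_int_sq ht, Real.rpow_neg ht.le, one_div]
  simp only [div_eq_mul_inv]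

lemma thetaNull_lt_of_lt {s t : ℝ} (hs : 0 < s) (hst : s < t) : thetaNull t < thetaNull s := by
  refine Summable.tsum_lt_tsum (i := 1) (fun n => ?_) ?_ (summable_thetaNull (hs.trans hst))
    (summable_thetaNull hs)
  · refine Real.exp_le_exp.2 ?_
    have := mul_nonneg (mul_nonneg Real.pi_pos.le (sub_nonneg.2 hst.le)) (sq_nonneg (n : ℝ))
    linarith
  · refine Real.exp_lt_exp.2 ?_
    have := mul_pos Real.pi_pos (sub_pos.2 hst)
    push_cast; linarith

lemma thetaNull_pos {t : ℝ} (ht : 0 < t) : 0 < thetaNull t :=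
  (summable_thetaNull ht).tsum_pos (fun _ => (Real.exp_pos _).le) 0 (Real.exp_pos _)

/-! ### Parity dissection and the duplication formula -/

lemma tsum_exp_even {t : ℝ} :
    ∑' n : ℤ, Real.exp (-Real.pi * t * ((2 * n : ℤ) : ℝ) ^ 2) = thetaNull (4 * t) := by
  unfold thetaNull
  refine tsum_congr fun n => ?_
  congr 1; push_cast; ring

lemma summable_exp_even {t : ℝ} (ht : 0 < t) :
    Summable fun n : ℤ => Real.exp (-Real.pi * t * ((2 * n : ℤ) : ℝ) ^ 2) :=
  (summable_thetaNull ht).comp_injective (fun a b h => by simpa using h)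

lemma summable_exp_odd {t : ℝ} (ht : 0 < t) :
    Summable fun n : ℤ => Real.exp (-Real.pi * t * ((2 * n + 1 : ℤ) : ℝ) ^ 2) :=
  (summable_thetaNull ht).comp_injective (i := fun n : ℤ => 2 * n + 1)
    (fun a b h => by simpa using h)

/-- Integers split into even and odd ones. -/
def evenOddEquiv : ℤ ⊕ ℤ ≃ ℤ where
  toFun := Sum.elim (fun n => 2 * n) (fun n => 2 * n + 1)
  invFun m := if m % 2 = 0 then Sum.inl (m / 2) else Sum.inr (m / 2)
  left_inv := by
    rintro (n | n)
    · simp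
    · have h : ¬ (2 * n + 1) % 2 = 0 := by omega
      simp only [Sum.elim_inr, h, if_false, Sum.inr.injEq]; omega
  right_inv m := by
    by_cases h : m % 2 = 0
    · simp only [h, if_true, Sum.elim_inl]; omega
    · simp only [h, if_false, Sum.elim_inr]; omega

lemma tsum_exp_odd {t : ℝ} (ht : 0 < t) :
    ∑' n : ℤ, Real.exp (-Real.pi * t * ((2 * n + 1 : ℤ) : ℝ) ^ 2)
      = thetaNull t - thetaNull (4 * t) := by
  rw [← tsum_exp_even, eq_sub_iff_add_eq', thetaNull]
  rw [← evenOddEquiv.tsum_eq fun n : ℤ => Real.exp (-Real.pi * t * (n : ℝ) ^ 2)]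
  exact (HasSum.sum (f := fun x => Real.exp (-Real.pi * t * (evenOddEquiv x : ℝ) ^ 2))
    (summable_exp_even ht).hasSum (summable_exp_odd ht).hasSum).tsum_eq.symm

/-- Pairs of integers of the same parity, both even or both odd, parametrized by
half sum and half difference. -/
def sumDiffEquiv : (ℤ × ℤ) ⊕ (ℤ × ℤ) ≃ ℤ × ℤ where
  toFun := Sum.elim (fun p => (p.1 + p.2, p.1 - p.2)) (fun p => (p.1 + p.2 + 1, p.1 - p.2))
  invFun u := if (u.1 + u.2) % 2 = 0 then Sum.inl ((u.1 + u.2) / 2, (u.1 - u.2) / 2)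
    else Sum.inr ((u.1 + u.2 - 1) / 2, (u.1 - u.2 - 1) / 2)
  left_inv := by
    rintro (⟨p, r⟩ | ⟨p, r⟩)
    · have h : (p + r + (p - r)) % 2 = 0 := by omega
      simp only [Sum.elim_inl, h, if_true, Sum.inl.injEq, Prod.mk.injEq]
      omega
    · have h : ¬ (p + r + 1 + (p - r)) % 2 = 0 := by omega
      simp only [Sum.elim_inr, h, if_false, Sum.inr.injEq, Prod.mk.injEq]
      omega
  right_inv := by
    rintro ⟨u, v⟩
    by_cases h : (u + v) % 2 = 0
    · simp only [h, if_true, Sum.elim_inl, Prod.mk.injEq]; omega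
    · simp only [h, if_false, Sum.elim_inr, Prod.mk.injEq]; omega

/-- Expand θ(2t)² over pairs (u, v) and split by the parity of u + v. As 2(u² + v²) = (u + v)² + (u
- v)², equal parities give sums of two even squares and opposite parities sums of two odd squares.
-/
lemma thetaNull_sq {t : ℝ} (ht : 0 < t) :
    (thetaNull t - thetaNull (4 * t)) ^ 2 + thetaNull (4 * t) ^ 2 = thetaNull (2 * t) ^ 2 := by
  have key : ∀ {g : ℤ → ℝ}, Summable g → (∀ n, 0 ≤ g n) →
      HasSum (fun p : ℤ × ℤ => g p.1 * g p.2) ((∑' n, g n) ^ 2) := fun {g} hg h0 => by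
    rw [sq]
    exact hg.hasSum.mul hg.hasSum (hg.mul_of_nonneg hg h0 h0)
  have h2 := key (summable_thetaNull (t := 2 * t) (by positivity)) fun _ => (Real.exp_pos _).le
  have he := key (summable_exp_even ht) fun _ => (Real.exp_pos _).le
  have ho := key (summable_exp_odd ht) fun _ => (Real.exp_pos _).le
  rw [tsum_exp_even] at he
  rw [tsum_exp_odd ht] at ho
  rw [← sumDiffEquiv.hasSum_iff] at h2
  rw [add_comm]
  refine (HasSum.sum ?_ ?_).unique h2 
  · convert he using 2 with p
    simp only [sumDiffEquiv, Function.comp, Equiv.coe_fn_mk, Sum.elim_inl, ← Real.exp_add]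
    congr 1; push_cast; ring
  · convert ho using 2 with p
    simp only [sumDiffEquiv, Function.comp, Equiv.coe_fn_mk, Sum.elim_inr, ← Real.exp_add]
    congr 1; push_cast; ring

/-! ### θ₄, the ratio θ₂/θ₃ and their algebraic relations -/

/-- The theta constant `θ₄`, expressed by `θ₃`. -/
noncomputable def thetaFour (t : ℝ) : ℝ := 2 * thetaNull (4 * t) - thetaNull t

/-- The quotient `θ₂ / θ₃`, expressed by `θ₃`. -/
noncomputable def thetaRatio (t : ℝ) : ℝ := thetaNull (t / 4) / thetaNull t - 1

lemma thetaNull_sq_add_thetaFour_sq {t : ℝ} (ht : 0 < t) :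
    thetaNull t ^ 2 + thetaFour t ^ 2 = 2 * thetaNull (2 * t) ^ 2 := by
  rw [← thetaNull_sq ht, thetaFour]; ring

/-- With the preceding identity, this says that `(θ₃², θ₄²)` at 2t consists of the arithmetic and
geometric means of the pair at t. -/
lemma thetaNull_mul_thetaFour {t : ℝ} (ht : 0 < t) :
    thetaNull t * thetaFour t = thetaFour (2 * t) ^ 2 := by
  have h1 := thetaNull_sq_add_thetaFour_sq ht
  have h2 := thetaNull_sq_add_thetaFour_sq (t := 2 * t) (by positivity)
  rw [show 2 * (2 * t) = 4 * t by ring] at h2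
  have h3 : 2 * thetaNull (4 * t) = thetaNull t + thetaFour t := by rw [thetaFour]; ring
  have h4 : (2 * thetaNull (4 * t)) ^ 2 = (thetaNull t + thetaFour t) ^ 2 := by rw [h3]
  linarith

lemma thetaRatio_pos {t : ℝ} (ht : 0 < t) : 0 < thetaRatio t := by
  have := thetaNull_lt_of_lt (s := t / 4) (t := t) (by positivity) (by linarith)
  rw [thetaRatio, sub_pos, one_lt_div (thetaNull_pos ht)]
  exact this

lemma one_add_thetaRatio (t : ℝ) : 1 + thetaRatio t = thetaNull (t / 4) / thetaNull t := by
  rw [thetaRatio]; ring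

/-- Jacobi's identity θ₃⁴ = θ₂⁴ + θ₄⁴, obtained from the duplication formula at t/4, t/2 and t. -/
lemma one_sub_thetaRatio_pow {t : ℝ} (ht : 0 < t) :
    1 - thetaRatio t ^ 4 = (thetaFour t / thetaNull t) ^ 4 := by
  have h0 := (thetaNull_pos ht).ne'
  have h1 := thetaNull_sq (t := t / 4) (by positivity)
  have h2 := thetaNull_sq (t := t / 2) (by positivity)
  have h3 := thetaNull_sq ht
  rw [show 4 * (t / 4) = t by ring, show 2 * (t / 4) = t / 2 by ring] at h1
  rw [show 4 * (t / 2) = 2 * t by ring, show 2 * (t / 2) = t by ring] at h2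
  rw [thetaRatio, thetaFour, div_sub_one h0, div_pow, div_pow, one_sub_div (by positivity)]
  congr 1
  generalize thetaNull (t / 4) = p at *
  generalize thetaNull (t / 2) = r at *
  generalize thetaNull (2 * t) = s at *
  generalize thetaNull (4 * t) = u at *
  generalize thetaNull t = v at *
  -- In classical terms, θ₂(t)² = 2θ₃(2t)θ₂(2t).
  have e2 : (p - v) ^ 2 = 2 * s * (r - s) := by linarith
  have e4 : (2 * u - v) ^ 2 = 2 * s ^ 2 - v ^ 2 := by linarith
  rw [show (p - v) ^ 4 = ((p - v) ^ 2) ^ 2 by ring,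
    show (2 * u - v) ^ 4 = ((2 * u - v) ^ 2) ^ 2 by ring, e2, e4]
  linear_combination -4 * s ^ 2 * h2

lemma thetaFour_div_thetaNull {t : ℝ} (ht : 0 < t) :
    thetaFour t / thetaNull t = (1 - thetaRatio (4 * t)) / (1 + thetaRatio (4 * t)) := by
  have h0 := (thetaNull_pos ht).ne'
  have h1 := (thetaNull_pos (t := 4 * t) (by positivity)).ne'
  rw [one_add_thetaRatio, thetaRatio, thetaFour, show 4 * t / 4 = t by ring]
  field_simp
  ring

lemma thetaNull_quarter : thetaNull (1 / 4) = 2 * thetaNull 4 := by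
  rw [thetaNull_inv (by norm_num), show (1 / 4 : ℝ) = 2 ^ (-2 : ℝ) by
    rw [Real.rpow_neg (by norm_num)]; norm_num, ← Real.rpow_mul (by norm_num)]
  norm_num [Real.rpow_neg]

/-- Inversion exchanges θ₂ and θ₄, so they agree at the fixed point t = 1; Jacobi's identity then
yields the initial value of `d`. -/
lemma thetaRatio_one : thetaRatio 1 = thetaFour 1 / thetaNull 1 := by
  have h0 := (thetaNull_pos one_pos).ne'
  rw [thetaRatio, thetaFour, thetaNull_quarter, mul_one]
  field_simp

lemma thetaRatio_one_pow : thetaRatio 1 ^ 4 = 1 / 2 := by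
  have := one_sub_thetaRatio_pow one_pos
  rw [← thetaRatio_one] at this
  linarith

lemma thetaFour_pos_of_double {t : ℝ} (ht : 0 < t) (h : thetaFour (2 * t) ≠ 0) :
    0 < thetaFour t := by
  have h1 : 0 < thetaNull t * thetaFour t := by
    rw [thetaNull_mul_thetaFour ht]; positivity
  exact pos_of_mul_pos_right h1 (thetaNull_pos ht).le

/-- The sign of θ₄ is not visible from its definition. Nonvanishing propagates upwards through
θ₃(t)θ₄(t) = θ₄(2t)²; the same relation then turns nonvanishing at 2t into positivity at t. -/
lemma thetaFour_two_pow_ne_zero (n : ℕ) : thetaFour (2 ^ n) ≠ 0 := by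
  induction n with
  | zero =>
    intro h
    have h1 := thetaRatio_one_pow
    rw [thetaRatio_one, ← pow_zero (2 : ℝ), h] at h1
    norm_num at h1
  | succ n ih =>
    intro h
    have h1 := thetaNull_mul_thetaFour (t := 2 ^ n) (by positivity)
    rw [← pow_succ', h, zero_pow two_ne_zero] at h1
    exact (mul_ne_zero (thetaNull_pos (by positivity)).ne' ih) h1

lemma thetaFour_two_pow_pos (n : ℕ) : 0 < thetaFour (2 ^ n) :=
  thetaFour_pos_of_double (by positivity) (by
    rw [← pow_succ']; exact thetaFour_two_pow_ne_zero _)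

lemma thetaFour_four_pow_pos (n : ℕ) : 0 < thetaFour (4 ^ n) := by
  rw [show (4 : ℝ) = 2 ^ 2 by norm_num, ← pow_mul]
  exact thetaFour_two_pow_pos _

/-! ### Holomorphy in the nome and asymptotics at infinity -/

/-- The nome series `1 + 2 ∑ z ^ (n ^ 2)`, the sum running over positive `n`. -/
noncomputable def thetaSeries (z : ℂ) : ℂ := 1 + 2 * ∑' n : ℕ, z ^ ((n + 1) ^ 2)

lemma norm_pow_succ_sq_le {r : ℝ} (h1 : r < 1) (n : ℕ) {z : ℂ} (hz : z ∈ Metric.ball (0 : ℂ) r) :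
    ‖z ^ ((n + 1) ^ 2)‖ ≤ r ^ n := by
  rw [mem_ball_zero_iff] at hz
  have h0 : 0 ≤ r := (norm_nonneg z).trans hz.le
  rw [norm_pow]
  exact (pow_le_pow_left₀ (norm_nonneg _) hz.le _).trans
    (pow_le_pow_of_le_one h0 h1.le (by nlinarith))

lemma differentiableOn_thetaSeries : DifferentiableOn ℂ thetaSeries (Metric.ball 0 1) := by
  intro z hz
  rw [mem_ball_zero_iff] at hz
  obtain ⟨r, hzr, hr1⟩ := exists_between hz
  have h := Complex.differentiableOn_tsum_of_summable_norm (F := fun (n : ℕ) (z : ℂ) => z ^ ((n + 1) ^ 2))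
    (U := Metric.ball (0 : ℂ) r)
    (summable_geometric_of_lt_one ((norm_nonneg z).trans hzr.le) hr1)
    (fun n => (differentiable_pow _).differentiableOn) Metric.isOpen_ball
    (fun n w hw => norm_pow_succ_sq_le hr1 n hw)
  refine DifferentiableAt.differentiableWithinAt ?_
  exact ((h.differentiableAt (Metric.isOpen_ball.mem_nhds (by simpa using hzr))).const_mul
    2).const_add 1

lemma deriv_thetaSeries_zero : deriv thetaSeries 0 = 2 := by
  have hr : (1 / 2 : ℝ) < 1 := by norm_num
  have hu := summable_geometric_of_lt_one (r := (1 / 2 : ℝ)) (by norm_num) hr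
  have hd : ∀ n : ℕ, DifferentiableOn ℂ (fun z : ℂ => z ^ ((n + 1) ^ 2))
      (Metric.ball (0 : ℂ) (1 / 2)) := fun n => (differentiable_pow _).differentiableOn
  have h0 : (0 : ℂ) ∈ Metric.ball (0 : ℂ) (1 / 2) := by simp
  have h := Complex.hasSum_deriv_of_summable_norm hu hd Metric.isOpen_ball
    (fun n w hw => norm_pow_succ_sq_le hr n hw) h0
  have h' := (Complex.differentiableOn_tsum_of_summable_norm hu hd Metric.isOpen_ball
    (fun n w hw => norm_pow_succ_sq_le hr n hw)).differentiableAt (Metric.isOpen_ball.mem_nhds h0)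
  have h2 : HasSum (fun n : ℕ => deriv (fun z : ℂ => z ^ ((n + 1) ^ 2)) 0) 1 := by
    convert hasSum_single (f := fun n : ℕ => deriv (fun z : ℂ => z ^ ((n + 1) ^ 2)) 0) 0 ?_ using 1
    · simp
    · intro n hn
      have : (n + 1) ^ 2 - 1 ≠ 0 := by
        have : 1 ≤ n := Nat.one_le_iff_ne_zero.2 hn
        have : 4 ≤ (n + 1) ^ 2 := by nlinarith
        omega
      simp [this]
  have h3 := (h'.hasDerivAt.const_mul (2 : ℂ)).const_add (1 : ℂ)
  rw [← h.tsum_eq, h2.tsum_eq, mul_one] at h3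
  exact h3.deriv

lemma thetaNull_eq_thetaSeries {t : ℝ} (ht : 0 < t) :
    (thetaNull t : ℂ) = thetaSeries (Real.exp (-Real.pi * t) : ℝ) := by
  have h1 : thetaNull t = 1 + 2 * ∑' n : ℕ, Real.exp (-Real.pi * t) ^ ((n + 1) ^ 2) := by
    rw [thetaNull, tsum_int_eq_zero_add_two_mul_tsum_pnat (fun n => by simp)
      (summable_thetaNull ht),
      tsum_pnat_eq_tsum_succ (f := fun n => Real.exp (-Real.pi * t * ((n : ℤ) : ℝ) ^ 2))]
    simp only [Int.cast_zero, ne_eq, OfNat.ofNat_ne_zero, not_false_eq_true, zero_pow, mul_zero,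
      Real.exp_zero, nsmul_eq_mul, Nat.cast_ofNat]
    congr 2
    refine tsum_congr fun n => ?_
    rw [← Real.exp_nat_mul]
    congr 1; push_cast; ring
  rw [h1, thetaSeries]
  push_cast
  rfl

/-- The derivative of `thetaNull`. -/
noncomputable def thetaNullDeriv (t : ℝ) : ℝ :=
  -Real.pi * Real.exp (-Real.pi * t) * (deriv thetaSeries (Real.exp (-Real.pi * t) : ℝ)).re

lemma exp_neg_pi_mul_mem_ball {t : ℝ} (ht : 0 < t) :
    ((Real.exp (-Real.pi * t) : ℝ) : ℂ) ∈ Metric.ball (0 : ℂ) 1 := by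
  rw [mem_ball_zero_iff, Complex.norm_real, Real.norm_eq_abs, Real.abs_exp, Real.exp_lt_one_iff]
  have := mul_pos Real.pi_pos ht
  linarith

lemma hasDerivAt_thetaNull {t : ℝ} (ht : 0 < t) :
    HasDerivAt thetaNull (thetaNullDeriv t) t := by
  have h1 : HasDerivAt (fun s : ℝ => Real.exp (-Real.pi * s))
      (Real.exp (-Real.pi * t) * (-Real.pi)) t := by
    simpa using ((hasDerivAt_id t).const_mul (-Real.pi)).exp
  have h2 := (differentiableOn_thetaSeries.differentiableAt
    (Metric.isOpen_ball.mem_nhds (exp_neg_pi_mul_mem_ball ht))).hasDerivAt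
  have h3 := h2.real_of_complex
  have h4 := h3.comp t h1
  refine (h4.congr_of_eventuallyEq ?_).congr_deriv (by rw [thetaNullDeriv]; ring)
  filter_upwards [lt_mem_nhds ht] with s hs
  rw [Function.comp, ← thetaNull_eq_thetaSeries hs, Complex.ofReal_re]

lemma tendsto_exp_neg_pi_mul : Tendsto (fun t : ℝ => Real.exp (-Real.pi * t)) atTop (𝓝 0) :=
  Real.tendsto_exp_atBot.comp (tendsto_id.const_mul_atTop_of_neg (by linarith [Real.pi_pos]))

/-- As t → ∞ the nome tends to 0, where the derivative of the nome series is continuous with value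
2. -/
lemma tendsto_thetaNullDeriv :
    Tendsto (fun t => thetaNullDeriv t / Real.exp (-Real.pi * t)) atTop (𝓝 (-2 * Real.pi)) := by
  have hc : ContinuousAt (deriv thetaSeries) 0 :=
    ((differentiableOn_thetaSeries.deriv Metric.isOpen_ball).differentiableAt
      (Metric.isOpen_ball.mem_nhds (by simp))).continuousAt
  have h1 : Tendsto (fun t : ℝ => ((Real.exp (-Real.pi * t) : ℝ) : ℂ)) atTop (𝓝 0) := by
    exact_mod_cast (Complex.continuous_ofReal.tendsto 0).comp tendsto_exp_neg_pi_mul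
  have h2 := ((Complex.continuous_re.tendsto _).comp (hc.tendsto.comp h1)).const_mul (-Real.pi)
  rw [deriv_thetaSeries_zero] at h2
  convert h2 using 2 with t
  · rw [thetaNullDeriv]
    have := (Real.exp_pos (-Real.pi * t)).ne'
    simp only [Function.comp]
    field_simp
  · simp; ring

lemma tendsto_thetaNull_sub_one :
    Tendsto (fun t => (thetaNull t - 1) / Real.exp (-Real.pi * t)) atTop (𝓝 2) := by
  have hd : HasDerivAt thetaSeries 2 0 := by
    rw [← deriv_thetaSeries_zero]
    exact (differentiableOn_thetaSeries.differentiableAt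
      (Metric.isOpen_ball.mem_nhds (by simp))).hasDerivAt
  have h1 : Tendsto (fun t : ℝ => ((Real.exp (-Real.pi * t) : ℝ) : ℂ)) atTop (𝓝[≠] 0) := by
    refine tendsto_nhdsWithin_iff.2 ⟨?_, Eventually.of_forall fun t => ?_⟩
    · exact_mod_cast (Complex.continuous_ofReal.tendsto 0).comp tendsto_exp_neg_pi_mul
    · simp [Complex.exp_ne_zero]
  have h2 := (Complex.continuous_re.tendsto _).comp ((hasDerivAt_iff_tendsto_slope.1 hd).comp h1)
  have h0 : thetaSeries 0 = 1 := by simp [thetaSeries]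
  refine Tendsto.congr' ?_ h2
  filter_upwards [eventually_gt_atTop 0] with t ht
  simp only [Function.comp, slope_def_field, ← thetaNull_eq_thetaSeries ht, h0, sub_zero]
  norm_cast

lemma tendsto_thetaNull : Tendsto thetaNull atTop (𝓝 1) := by
  have h := (tendsto_thetaNull_sub_one.mul tendsto_exp_neg_pi_mul).add_const 1
  rw [mul_zero, zero_add] at h
  refine h.congr fun t => ?_
  rw [div_mul_cancel₀ _ (Real.exp_pos _).ne', sub_add_cancel]

/-! ### The differential equation of θ₂/θ₃ along powers of 4 -/

/-- The derivative of `thetaRatio`. -/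
noncomputable def thetaRatioDeriv (t : ℝ) : ℝ :=
  (thetaNullDeriv (t / 4) / 4 * thetaNull t - thetaNull (t / 4) * thetaNullDeriv t)
    / thetaNull t ^ 2

lemma hasDerivAt_thetaRatio {t : ℝ} (ht : 0 < t) :
    HasDerivAt thetaRatio (thetaRatioDeriv t) t := by
  have h1 : HasDerivAt (fun s => thetaNull (s / 4)) (thetaNullDeriv (t / 4) * (1 / 4)) t :=
    HasDerivAt.comp (h₂ := thetaNull) (h := fun s => s / 4) t
      (hasDerivAt_thetaNull (t := t / 4) (by positivity)) ((hasDerivAt_id t).div_const 4)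
  refine ((h1.fun_div (hasDerivAt_thetaNull ht) (thetaNull_pos ht).ne').sub_const 1).congr_deriv ?_
  rw [thetaRatioDeriv]; ring

lemma thetaRatio_modular {t : ℝ} (ht : 0 < t) :
    (1 - thetaRatio t ^ 4) * (1 + thetaRatio (4 * t)) ^ 4 = (1 - thetaRatio (4 * t)) ^ 4 := by
  have h := thetaRatio_pos (t := 4 * t) (by positivity)
  rw [one_sub_thetaRatio_pow ht, thetaFour_div_thetaNull ht, div_pow, div_mul_cancel₀]
  positivity

/-- Implicit differentiation of the modular equation, followed by elimination through that equation.
-/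
lemma thetaRatioDeriv_modular {t : ℝ} (ht : 0 < t) :
    thetaRatioDeriv t * thetaRatio (4 * t) * (1 - thetaRatio (4 * t) ^ 4)
      = thetaRatioDeriv (4 * t) * thetaRatio t * (1 - thetaRatio (4 * t)) ^ 4 := by
  have hy : HasDerivAt (fun s => thetaRatio (4 * s)) (thetaRatioDeriv (4 * t) * 4) t := by
    simpa [Function.comp_def] using HasDerivAt.comp (h₂ := thetaRatio) (h := fun s => 4 * s) t
      (hasDerivAt_thetaRatio (t := 4 * t) (by positivity)) ((hasDerivAt_id t).const_mul 4)
  have hl := (((hasDerivAt_thetaRatio ht).fun_pow 4).const_sub 1).fun_mul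
    ((hy.const_add 1).fun_pow 4)
  have hr := (hy.const_sub 1).fun_pow 4
  have h2 := hl.unique (hr.congr_of_eventuallyEq (by
    filter_upwards [lt_mem_nhds ht] with s hs using thetaRatio_modular hs))
  have h1 := thetaRatio_modular ht
  have hd := thetaRatio_pos ht
  have hy0 := thetaRatio_pos (t := 4 * t) (by positivity)
  norm_num at h2
  generalize thetaRatio (4 * t) = y at *
  generalize thetaRatio t = d at *
  generalize thetaRatioDeriv (4 * t) = y' at *
  generalize thetaRatioDeriv t = d' at *
  refine mul_left_cancel₀ (show d ^ 3 * (1 + y) ^ 5 ≠ 0 by positivity) ?_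
  linear_combination -(1 + y) * y * (1 - y ^ 4) / 4 * h2 + (4 * y' * y * (1 - y ^ 4) +
    y' * (1 + y) * (1 - y) ^ 4) * h1

/-- The logarithmic derivative of `thetaRatio` relative to `(1 - thetaRatio ^ 4) θ₃ ^ 4`. -/
noncomputable def thetaRatioQuot (t : ℝ) : ℝ :=
  thetaRatioDeriv t / (thetaRatio t * (1 - thetaRatio t ^ 4) * thetaNull t ^ 4)

lemma thetaNull_eq_one_add_mul (t : ℝ) (ht : 0 < t) :
    thetaNull t = (1 + thetaRatio (4 * t)) * thetaNull (4 * t) := by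
  rw [one_add_thetaRatio, div_mul_cancel₀ _ (thetaNull_pos (by positivity)).ne']
  congr 1; ring

lemma thetaRatioQuot_four_mul {t : ℝ} (ht : 0 < t) (h : 0 < 1 - thetaRatio t ^ 4)
    (h4 : 0 < 1 - thetaRatio (4 * t) ^ 4) : thetaRatioQuot (4 * t) = thetaRatioQuot t := by
  have h1 := thetaRatio_modular ht
  have h2 := thetaRatioDeriv_modular ht
  have hd := thetaRatio_pos ht
  have hy0 := thetaRatio_pos (t := 4 * t) (by positivity)
  have hT := thetaNull_pos (t := 4 * t) (by positivity)
  rw [thetaRatioQuot, thetaRatioQuot, thetaNull_eq_one_add_mul t ht, div_eq_div_iff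
    (by positivity) (by positivity)]
  linear_combination -(thetaNull (4 * t)) ^ 4 * h2 + thetaRatioDeriv (4 * t) * thetaRatio t *
    (thetaNull (4 * t)) ^ 4 * h1

lemma tendsto_exp_quarter :
    Tendsto (fun t : ℝ => Real.exp (-Real.pi * (t / 4))) atTop (𝓝 0) :=
  tendsto_exp_neg_pi_mul.comp (tendsto_id.atTop_div_const (by norm_num))

lemma tendsto_exp_div_exp_quarter :
    Tendsto (fun t : ℝ => Real.exp (-Real.pi * t) / Real.exp (-Real.pi * (t / 4))) atTop
      (𝓝 0) := by
  have h := tendsto_exp_quarter.pow 3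
  rw [zero_pow three_ne_zero] at h
  refine h.congr fun t => ?_
  rw [← Real.exp_sub, ← Real.exp_nat_mul]
  congr 1; push_cast; ring

lemma tendsto_div_four : Tendsto (fun t : ℝ => t / 4) atTop atTop :=
  tendsto_id.atTop_div_const (by norm_num)

lemma tendsto_thetaRatio_div_exp :
    Tendsto (fun t => thetaRatio t / Real.exp (-Real.pi * (t / 4))) atTop (𝓝 2) := by
  have h1 := tendsto_thetaNull_sub_one.comp tendsto_div_four
  have h2 := tendsto_thetaNull_sub_one.mul tendsto_exp_div_exp_quarter
  have h3 := (h1.sub h2).div tendsto_thetaNull one_ne_zero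
  rw [mul_zero, sub_zero, div_one] at h3
  refine Tendsto.congr' ?_ h3
  filter_upwards [eventually_gt_atTop 0] with t ht
  have h0 := (thetaNull_pos ht).ne'
  have e1 := (Real.exp_pos (-Real.pi * t)).ne'
  have e2 := (Real.exp_pos (-Real.pi * (t / 4))).ne'
  simp only [Pi.div_apply, Function.comp, thetaRatio]
  field_simp
  ring

lemma tendsto_thetaRatio : Tendsto thetaRatio atTop (𝓝 0) := by
  have h := tendsto_thetaRatio_div_exp.mul tendsto_exp_quarter
  rw [mul_zero] at h
  exact h.congr fun t => div_mul_cancel₀ _ (Real.exp_pos _).ne'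

lemma tendsto_thetaRatioDeriv_div_exp :
    Tendsto (fun t => thetaRatioDeriv t / Real.exp (-Real.pi * (t / 4))) atTop
      (𝓝 (-(Real.pi / 2))) := by
  have h1 := ((tendsto_thetaNullDeriv.comp tendsto_div_four).div_const 4).mul tendsto_thetaNull
  have h2 := (tendsto_thetaNull.comp tendsto_div_four).mul
    (tendsto_thetaNullDeriv.mul tendsto_exp_div_exp_quarter)
  have h3 := (h1.sub h2).div (tendsto_thetaNull.pow 2) (by norm_num)
  rw [show (-2 * Real.pi / 4 * 1 - 1 * (-2 * Real.pi * 0)) / 1 ^ 2 = -(Real.pi / 2) by ring] at h3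
  refine Tendsto.congr' ?_ h3
  filter_upwards [eventually_gt_atTop 0] with t ht
  have h0 := (thetaNull_pos ht).ne'
  have e1 := (Real.exp_pos (-Real.pi * t)).ne'
  have e2 := (Real.exp_pos (-Real.pi * (t / 4))).ne'
  simp only [Pi.div_apply, Function.comp, thetaRatioDeriv]
  field_simp

lemma tendsto_thetaRatioQuot : Tendsto thetaRatioQuot atTop (𝓝 (-(Real.pi / 4))) := by
  have h1 := tendsto_thetaRatioDeriv_div_exp.div tendsto_thetaRatio_div_exp two_ne_zero
  have h2 := ((tendsto_thetaRatio.pow 4).const_sub 1).mul (tendsto_thetaNull.pow 4)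
  have h3 := h1.div h2 (by norm_num)
  rw [show -(Real.pi / 2) / 2 / ((1 - 0 ^ 4) * 1 ^ 4) = -(Real.pi / 4) by ring] at h3
  refine Tendsto.congr (fun t => ?_) h3
  have e2 := (Real.exp_pos (-Real.pi * (t / 4))).ne'
  simp only [Pi.div_apply, thetaRatioQuot]
  rw [div_div_div_cancel_right₀ e2, div_div, mul_assoc]

lemma one_sub_thetaRatio_four_pow_pos (n : ℕ) : 0 < 1 - thetaRatio (4 ^ n) ^ 4 := by
  rw [one_sub_thetaRatio_pow (by positivity)]
  have := thetaFour_four_pow_pos n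
  have := thetaNull_pos (t := 4 ^ n) (by positivity)
  positivity

/-- Invariance under t ↦ 4t makes the quotient constant along the powers of 4, hence equal to its
limit at infinity. -/
lemma thetaRatioQuot_four_pow (n : ℕ) : thetaRatioQuot (4 ^ n) = -(Real.pi / 4) := by
  have h : ∀ k : ℕ, thetaRatioQuot (4 ^ (n + k)) = thetaRatioQuot (4 ^ n) := by
    intro k
    induction k with
    | zero => rfl
    | succ k ih =>
      rw [← ih, ← add_assoc, pow_succ' (4 : ℝ) (n + k)]
      refine thetaRatioQuot_four_mul (by positivity) (one_sub_thetaRatio_four_pow_pos _) ?_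
      rw [← pow_succ']
      exact one_sub_thetaRatio_four_pow_pos _
  have h1 : Tendsto (fun k : ℕ => (4 : ℝ) ^ (n + k)) atTop atTop :=
    (tendsto_pow_atTop_atTop_of_one_lt (by norm_num)).comp
      (tendsto_atTop_mono (fun k => Nat.le_add_left k n) tendsto_id)
  have h2 := tendsto_thetaRatioQuot.comp h1
  exact tendsto_nhds_unique (tendsto_const_nhds.congr fun k => (h k).symm) h2

/-! ### The logarithmic derivative of θ₃ -/

/-- The logarithmic derivative of `thetaNull`. -/
noncomputable def thetaNullLogDeriv (t : ℝ) : ℝ := thetaNullDeriv t / thetaNull t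

/-- Logarithmic differentiation of 1 + θ₂/θ₃ = θ(t/4)/θ(t) at `t = 4 ^ (n + 1)`, with the derivative
of θ₂/θ₃ supplied by `thetaRatioQuot_four_pow`. -/
lemma thetaNullLogDeriv_sub (n : ℕ) :
    thetaNullLogDeriv (4 ^ n) - 4 * thetaNullLogDeriv (4 ^ (n + 1)) =
      -Real.pi * (thetaRatio (4 ^ (n + 1)) / (1 + thetaRatio (4 ^ (n + 1)))) *
        (1 - thetaRatio (4 ^ (n + 1)) ^ 4) * thetaNull (4 ^ (n + 1)) ^ 4 := by
  have h := thetaRatioQuot_four_pow (n + 1)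
  have h1 := one_sub_thetaRatio_four_pow_pos (n + 1)
  have h2 := thetaRatio_pos (t := 4 ^ (n + 1)) (by positivity)
  have h3 := thetaNull_pos (t := 4 ^ (n + 1)) (by positivity)
  have h4 := thetaNull_pos (t := 4 ^ n) (by positivity)
  have h5 : (4 : ℝ) ^ (n + 1) / 4 = 4 ^ n := by rw [pow_succ]; field_simp
  have h6 := thetaNull_eq_one_add_mul (4 ^ n) (by positivity)
  rw [← pow_succ'] at h6
  rw [thetaRatioQuot, div_eq_iff (by positivity), thetaRatioDeriv, h5,
    div_eq_iff (by positivity)] at h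
  rw [thetaNullLogDeriv, thetaNullLogDeriv]
  have h7 : 1 + thetaRatio (4 ^ (n + 1)) = thetaNull (4 ^ n) / thetaNull (4 ^ (n + 1)) := by
    rw [h6]; field_simp
  rw [h7]
  field_simp
  linear_combination 4 * h

/-- Differentiate the inversion formula at its fixed point. -/
lemma thetaNullLogDeriv_one : thetaNullLogDeriv 1 = -(1 / 4) := by
  have h1 : HasDerivAt (fun t : ℝ => t ^ (-(1 / 2) : ℝ) * thetaNull t⁻¹)
      (-(1 / 2) * thetaNull 1 - thetaNullDeriv 1) 1 := by
    have ha := Real.hasDerivAt_rpow_const (x := 1) (p := -(1 / 2)) (Or.inl one_ne_zero)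
    have hb : HasDerivAt (fun t : ℝ => thetaNull t⁻¹) (thetaNullDeriv 1⁻¹ * (-(1 ^ 2)⁻¹)) 1 :=
      (hasDerivAt_thetaNull (t := (1 : ℝ)⁻¹) (by norm_num)).comp 1 (hasDerivAt_inv one_ne_zero)
    refine (ha.fun_mul hb).congr_deriv ?_
    simp; ring
  have h2 := (hasDerivAt_thetaNull one_pos).unique (h1.congr_of_eventuallyEq (by
    filter_upwards [lt_mem_nhds one_pos] with t ht using thetaNull_inv ht))
  rw [thetaNullLogDeriv, div_eq_iff (thetaNull_pos one_pos).ne']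
  linarith

lemma tendsto_thetaNullLogDeriv :
    Tendsto (fun t => thetaNullLogDeriv t / Real.exp (-Real.pi * t)) atTop (𝓝 (-2 * Real.pi)) := by
  have h := tendsto_thetaNullDeriv.div tendsto_thetaNull one_ne_zero
  rw [div_one] at h
  exact h.congr fun t => div_right_comm _ _ _

/-! ### Gauss's integral for the arithmetic-geometric mean -/

/-- The integrand of the complete elliptic integral attached to the arithmetic-geometric mean
of `a` and `b`. -/
noncomputable def agmKernel (a b x : ℝ) : ℝ := (√((x ^ 2 + a ^ 2) * (x ^ 2 + b ^ 2)))⁻¹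

lemma integral_agmKernel_eq_Ioi (a b : ℝ) :
    ∫ x, agmKernel a b x = 2 * ∫ x in Set.Ioi (0 : ℝ), agmKernel a b x := by
  rw [← integral_comp_abs]
  simp only [agmKernel, sq_abs]

lemma image_landen_Ioi {c : ℝ} (hc : 0 < c) :
    (fun x : ℝ => (x - c ^ 2 / x) / 2) '' Set.Ioi 0 = Set.univ := by
  refine Set.eq_univ_of_forall fun u => ?_
  have h : |u| < √(u ^ 2 + c ^ 2) := Real.lt_sqrt_of_sq_lt (by rw [sq_abs]; nlinarith)
  have h2 : √(u ^ 2 + c ^ 2) ^ 2 = u ^ 2 + c ^ 2 := Real.sq_sqrt (by positivity)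
  have h3 : 0 < u + √(u ^ 2 + c ^ 2) := by linarith [neg_abs_le u]
  refine ⟨u + √(u ^ 2 + c ^ 2), h3, ?_⟩
  have := h3.ne'
  simp only
  field_simp
  linarith

lemma injOn_landen_Ioi (c : ℝ) :
    Set.InjOn (fun x : ℝ => (x - c ^ 2 / x) / 2) (Set.Ioi 0) := by
  intro x hx y hy h
  rw [Set.mem_Ioi] at hx hy
  have h1 : (x - y) * (x * y + c ^ 2) = 0 := by
    simp only at h
    field_simp at h
    linear_combination h
  have h2 : x * y + c ^ 2 ≠ 0 := by positivity
  exact sub_eq_zero.1 ((mul_eq_zero.1 h1).resolve_right h2)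

/-- Landen's substitution u = (x - ab/x)/2 maps the positive half-line bijectively onto ℝ; evenness
of the kernel accounts for the factor 2. -/
lemma integral_agmKernel_step {a b c : ℝ} (ha : 0 < a) (hb : 0 < b) (hc : 0 < c)
    (h : c ^ 2 = a * b) : ∫ x, agmKernel ((a + b) / 2) c x = ∫ x, agmKernel a b x := by
  have hd : ∀ x ∈ Set.Ioi (0 : ℝ), HasDerivWithinAt (fun x : ℝ => (x - c ^ 2 / x) / 2)
      ((1 + c ^ 2 / x ^ 2) / 2) (Set.Ioi 0) x := by
    intro x hx
    have hx' : x ≠ 0 := (Set.mem_Ioi.1 hx).ne'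
    have := ((hasDerivAt_id x).sub ((hasDerivAt_inv hx').const_mul (c ^ 2))).div_const 2
    refine HasDerivAt.hasDerivWithinAt (this.congr_deriv ?_)
    field_simp
    ring
  have h1 := MeasureTheory.integral_image_eq_integral_abs_deriv_smul measurableSet_Ioi hd
    (injOn_landen_Ioi c) (agmKernel ((a + b) / 2) c)
  rw [image_landen_Ioi hc, MeasureTheory.setIntegral_univ] at h1
  rw [h1, integral_agmKernel_eq_Ioi a b, ← MeasureTheory.integral_const_mul]
  refine MeasureTheory.setIntegral_congr_fun measurableSet_Ioi fun x hx => ?_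
  rw [Set.mem_Ioi] at hx
  have e1 : (((x - c ^ 2 / x) / 2) ^ 2 + ((a + b) / 2) ^ 2) * (((x - c ^ 2 / x) / 2) ^ 2 + c ^ 2)
      = ((x ^ 2 + a ^ 2) * (x ^ 2 + b ^ 2)) * ((x ^ 2 + c ^ 2) / (4 * x ^ 2)) ^ 2 := by
    have : ((x - c ^ 2 / x) / 2) ^ 2 + ((a + b) / 2) ^ 2
        = (x ^ 2 + a ^ 2) * (x ^ 2 + b ^ 2) / (4 * x ^ 2) := by
      rw [h]; field_simp; ring
    rw [this]; field_simp; ring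
  simp only [agmKernel, smul_eq_mul]
  rw [e1, Real.sqrt_mul (by positivity), Real.sqrt_sq (by positivity),
    abs_of_pos (by positivity)]
  have : 0 < √((x ^ 2 + a ^ 2) * (x ^ 2 + b ^ 2)) := by positivity
  field_simp
  ring

lemma inv_sq_add_sq_eq {a : ℝ} (ha : 0 < a) (x : ℝ) :
    (x ^ 2 + a ^ 2)⁻¹ = (a ^ 2)⁻¹ * (1 + (x / a) ^ 2)⁻¹ := by
  rw [← mul_inv]; congr 1; field_simp; ring

lemma integral_inv_sq_add_sq_pos {a : ℝ} (ha : 0 < a) : ∫ x : ℝ, (x ^ 2 + a ^ 2)⁻¹ = Real.pi / a := by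
  simp only [inv_sq_add_sq_eq ha]
  rw [MeasureTheory.integral_const_mul,
    MeasureTheory.Measure.integral_comp_div (fun x => (1 + x ^ 2)⁻¹) a,
    integral_univ_inv_one_add_sq, abs_of_pos ha, smul_eq_mul]
  field_simp

lemma integrable_inv_sq_add_sq {a : ℝ} (ha : 0 < a) :
    MeasureTheory.Integrable fun x : ℝ => (x ^ 2 + a ^ 2)⁻¹ := by
  simp only [inv_sq_add_sq_eq ha]
  exact (integrable_inv_one_add_sq.comp_div ha.ne').const_mul _

lemma agmKernel_le {a b : ℝ} (hb : 0 < b) (hab : b ≤ a) (x : ℝ) :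
    agmKernel a b x ≤ (x ^ 2 + b ^ 2)⁻¹ := by
  refine inv_anti₀ (by positivity) (Real.le_sqrt_of_sq_le ?_)
  rw [sq (x ^ 2 + b ^ 2)]
  gcongr

lemma le_agmKernel {a b : ℝ} (hb : 0 < b) (hab : b ≤ a) (x : ℝ) :
    (x ^ 2 + a ^ 2)⁻¹ ≤ agmKernel a b x := by
  have ha := hb.trans_le hab
  refine inv_anti₀ (by positivity) (Real.sqrt_le_iff.2 ⟨by positivity, ?_⟩)
  rw [sq (x ^ 2 + a ^ 2)]
  gcongr

lemma integrable_agmKernel {a b : ℝ} (hb : 0 < b) (hab : b ≤ a) :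
    MeasureTheory.Integrable (agmKernel a b) := by
  have ha := hb.trans_le hab
  refine (integrable_inv_sq_add_sq hb).mono' ?_ (Eventually.of_forall fun x => ?_)
  · refine Continuous.aestronglyMeasurable ?_
    unfold agmKernel
    refine Continuous.inv₀ (by fun_prop) fun x => ?_
    positivity
  · rw [Real.norm_of_nonneg (by unfold agmKernel; positivity)]
    exact agmKernel_le hb hab x

lemma integral_agmKernel_mem_Icc {a b : ℝ} (hb : 0 < b) (hab : b ≤ a) :
    ∫ x, agmKernel a b x ∈ Set.Icc (Real.pi / a) (Real.pi / b) := by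
  rw [← integral_inv_sq_add_sq_pos hb, ← integral_inv_sq_add_sq_pos (hb.trans_le hab)]
  exact ⟨MeasureTheory.integral_mono (integrable_inv_sq_add_sq (hb.trans_le hab))
    (integrable_agmKernel hb hab) (le_agmKernel hb hab),
    MeasureTheory.integral_mono (integrable_agmKernel hb hab) (integrable_inv_sq_add_sq hb)
    (agmKernel_le hb hab)⟩

/-- The integral is unchanged along t = 2^n, while θ₃ and θ₄ tend to 1; comparison with π/θ₃² and
π/θ₄² squeezes it to π. -/
lemma integral_agmKernel_theta :
    ∫ x, agmKernel (thetaNull 1 ^ 2) (thetaFour 1 ^ 2) x = Real.pi := by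
  have h : ∀ n : ℕ, ∫ x, agmKernel (thetaNull (2 ^ n) ^ 2) (thetaFour (2 ^ n) ^ 2) x =
      ∫ x, agmKernel (thetaNull 1 ^ 2) (thetaFour 1 ^ 2) x := by
    intro n
    induction n with
    | zero => rw [pow_zero]
    | succ n ih =>
      have h2 : (0 : ℝ) < 2 ^ n := by positivity
      have h4 := thetaFour_two_pow_pos n
      have h5 := thetaFour_two_pow_pos (n + 1)
      have h3 := thetaNull_pos h2
      have e := thetaNull_sq_add_thetaFour_sq h2
      have e' := thetaNull_mul_thetaFour h2
      rw [pow_succ' (2 : ℝ)] at h5 ⊢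
      have hs := integral_agmKernel_step (a := thetaNull (2 ^ n) ^ 2) (b := thetaFour (2 ^ n) ^ 2)
        (c := thetaFour (2 * 2 ^ n) ^ 2) (by positivity) (by positivity) (by positivity)
        (by rw [← e']; ring)
      rw [← ih, ← hs, e, mul_div_cancel_left₀ _ two_ne_zero]
  have ht : Tendsto (fun n : ℕ => (2 : ℝ) ^ n) atTop atTop :=
    tendsto_pow_atTop_atTop_of_one_lt (by norm_num)
  have h3 := tendsto_thetaNull.comp ht
  have h4 : Tendsto (fun n : ℕ => thetaFour (2 ^ n)) atTop (𝓝 1) := by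
    have := ((tendsto_thetaNull.comp (ht.const_mul_atTop (by norm_num : (0 : ℝ) < 4))).const_mul
      2).sub h3
    norm_num at this
    exact this
  have l1 : Tendsto (fun n : ℕ => Real.pi / thetaNull (2 ^ n) ^ 2) atTop (𝓝 Real.pi) := by
    simpa [Function.comp_def, Pi.div_def] using
      (tendsto_const_nhds (x := Real.pi)).div (h3.pow 2) (by norm_num)
  have l2 : Tendsto (fun n : ℕ => Real.pi / thetaFour (2 ^ n) ^ 2) atTop (𝓝 Real.pi) := by
    simpa [Function.comp_def, Pi.div_def] using
      (tendsto_const_nhds (x := Real.pi)).div (h4.pow 2) (by norm_num)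
  have hm : ∀ n : ℕ, ∫ x, agmKernel (thetaNull 1 ^ 2) (thetaFour 1 ^ 2) x ∈
      Set.Icc (Real.pi / thetaNull (2 ^ n) ^ 2) (Real.pi / thetaFour (2 ^ n) ^ 2) := by
    intro n
    rw [← h n]
    have h4 := thetaFour_two_pow_pos n
    refine integral_agmKernel_mem_Icc (by positivity) (pow_le_pow_left₀ h4.le ?_ 2)
    have := thetaNull_lt_of_lt (s := 2 ^ n) (t := 4 * 2 ^ n) (by positivity)
      (by linarith [pow_pos (two_pos (α := ℝ)) n])
    rw [thetaFour]; linarith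
  exact le_antisymm (ge_of_tendsto' l2 fun n => (hm n).2) (le_of_tendsto' l1 fun n => (hm n).1)

/-! ### The lemniscatic case and the value θ₃(1) -/

lemma integral_rpow_mul_one_sub_rpow {u v : ℝ} (hu : 0 < u) (hv : 0 < v) :
    ∫ r in Set.Ioo (0 : ℝ) 1, r ^ (u - 1) * (1 - r) ^ (v - 1)
      = Real.Gamma u * Real.Gamma v / Real.Gamma (u + v) := by
  have h := ProbabilityTheory.beta_eq_betaIntegralReal u v hu hv
  rw [ProbabilityTheory.beta] at h
  rw [h, Complex.betaIntegral, ← MeasureTheory.integral_Ioc_eq_integral_Ioo,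
    ← intervalIntegral.integral_of_le zero_le_one, ← Complex.ofReal_re (∫ r in (0 : ℝ)..1, _),
    ← intervalIntegral.integral_ofReal]
  congr 1
  refine intervalIntegral.integral_congr fun r hr => ?_
  rw [Set.uIcc_of_le zero_le_one] at hr
  rw [Complex.ofReal_mul, Complex.ofReal_cpow hr.1, Complex.ofReal_cpow (sub_nonneg.2 hr.2)]
  push_cast
  rfl

lemma image_lemniscate {b : ℝ} (hb : 0 < b) :
    (fun r : ℝ => b * √((√r)⁻¹ - 1)) '' Set.Ioo 0 1 = Set.Ioi 0 := by
  ext x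
  constructor
  · rintro ⟨r, hr, rfl⟩
    have h1 : 0 < √r := Real.sqrt_pos.2 hr.1
    have h2 : √r < 1 := by rw [Real.sqrt_lt' one_pos]; simpa using hr.2
    have : 0 < (√r)⁻¹ - 1 := sub_pos.2 ((one_lt_inv₀ h1).2 h2)
    rw [Set.mem_Ioi]
    positivity
  · intro hx
    rw [Set.mem_Ioi] at hx
    have h : 1 < (x / b) ^ 2 + 1 := by
      have : 0 < x / b := by positivity
      nlinarith
    refine ⟨(((x / b) ^ 2 + 1)⁻¹) ^ 2, ⟨by positivity, ?_⟩, ?_⟩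
    · exact pow_lt_one₀ (by positivity) (inv_lt_one_of_one_lt₀ h) two_ne_zero
    · simp only
      rw [Real.sqrt_sq (by positivity), inv_inv, add_sub_cancel_right,
        Real.sqrt_sq (by positivity)]
      field_simp

lemma injOn_lemniscate {b : ℝ} (hb : 0 < b) :
    Set.InjOn (fun r : ℝ => b * √((√r)⁻¹ - 1)) (Set.Ioo 0 1) := by
  have hp : ∀ r ∈ Set.Ioo (0 : ℝ) 1, 0 ≤ (√r)⁻¹ - 1 := fun r hr => by
    have h1 : 0 < √r := Real.sqrt_pos.2 hr.1
    have h2 : √r < 1 := by rw [Real.sqrt_lt' one_pos]; simpa using hr.2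
    exact (sub_pos.2 ((one_lt_inv₀ h1).2 h2)).le
  intro r hr s hs h
  have h1 := (Real.sqrt_inj (hp r hr) (hp s hs)).1 (mul_left_cancel₀ hb.ne' h)
  exact (Real.sqrt_inj hr.1.le hs.1.le).1 (inv_injective (sub_left_injective h1))

/-- The substitution r = (1 + x²/b²)^(-2) produces the Beta integral B(1/4, 1/2). -/
lemma integral_agmKernel_lemniscate {a b : ℝ} (hb : 0 < b) (h : a ^ 2 = 2 * b ^ 2) :
    ∫ x, agmKernel a b x = (2 * b)⁻¹ *
      (Real.Gamma (1 / 4) * Real.Gamma (1 / 2) / Real.Gamma (1 / 4 + 1 / 2)) := by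
  have hd : ∀ r ∈ Set.Ioo (0 : ℝ) 1, HasDerivWithinAt (fun r : ℝ => b * √((√r)⁻¹ - 1))
      (b * (-(1 / (2 * √r)) / √r ^ 2 / (2 * √((√r)⁻¹ - 1)))) (Set.Ioo 0 1) r := by
    intro r hr
    have h1 : 0 < √r := Real.sqrt_pos.2 hr.1
    have h2 : √r < 1 := by rw [Real.sqrt_lt' one_pos]; simpa using hr.2
    have h3 : 0 < (√r)⁻¹ - 1 := sub_pos.2 ((one_lt_inv₀ h1).2 h2)
    exact (((((Real.hasDerivAt_sqrt hr.1.ne').inv h1.ne').sub_const 1).sqrt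
      h3.ne').const_mul b).hasDerivWithinAt
  have h1 := MeasureTheory.integral_image_eq_integral_abs_deriv_smul measurableSet_Ioo hd
    (injOn_lemniscate hb) (agmKernel a b)
  rw [image_lemniscate hb] at h1
  rw [integral_agmKernel_eq_Ioi, h1, ← integral_rpow_mul_one_sub_rpow (by norm_num) (by norm_num),
    ← MeasureTheory.integral_const_mul, ← MeasureTheory.integral_const_mul]
  refine MeasureTheory.setIntegral_congr_fun measurableSet_Ioo fun r hr => ?_
  -- Writing r = y⁴ removes the nested roots.
  obtain ⟨y, hy, rfl⟩ : ∃ y : ℝ, 0 < y ∧ r = y ^ 4 :=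
    ⟨r ^ (1 / 4 : ℝ), Real.rpow_pos_of_pos hr.1 _, by
      rw [← Real.rpow_natCast, ← Real.rpow_mul hr.1.le]; norm_num⟩
  have hy1 : y < 1 := (pow_lt_one_iff_of_nonneg hy.le (by norm_num)).1 hr.2
  have hs : √(y ^ 4) = y ^ 2 := by
    rw [show y ^ 4 = (y ^ 2) ^ 2 by ring, Real.sqrt_sq (by positivity)]
  have hm : 0 < 1 - y ^ 2 := by nlinarith
  have hy3 : (y ^ 4) ^ (1 / 4 - 1 : ℝ) = (y ^ 3)⁻¹ := by
    rw [← Real.rpow_natCast y 4, ← Real.rpow_mul hy.le, ← Real.rpow_natCast y 3,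
      ← Real.rpow_neg hy.le]
    norm_num
  have hy4 : (1 - y ^ 4) ^ (1 / 2 - 1 : ℝ) = (√(1 - y ^ 2) * √(1 + y ^ 2))⁻¹ := by
    rw [← Real.sqrt_mul hm.le, Real.sqrt_eq_rpow, ← Real.rpow_neg (by positivity)]
    norm_num
    congr 1
    ring
  have hq : √((y ^ 2)⁻¹ - 1) = √(1 - y ^ 2) / y := by
    rw [show (y ^ 2)⁻¹ - 1 = (1 - y ^ 2) / y ^ 2 by field_simp, Real.sqrt_div hm.le,
      Real.sqrt_sq hy.le]
  have hk : agmKernel a b (b * (√(1 - y ^ 2) / y)) = y ^ 2 / (b ^ 2 * √(1 + y ^ 2)) := by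
    have e : ((b * (√(1 - y ^ 2) / y)) ^ 2 + a ^ 2) * ((b * (√(1 - y ^ 2) / y)) ^ 2 + b ^ 2)
        = (b ^ 2 / y ^ 2) ^ 2 * (1 + y ^ 2) := by
      rw [mul_pow, div_pow, Real.sq_sqrt hm.le, h]
      field_simp
      ring
    rw [agmKernel, e, Real.sqrt_mul (by positivity), Real.sqrt_sq (by positivity)]
    field_simp
  simp only [smul_eq_mul]
  rw [hs, hq, hk, hy3, hy4]
  have h5 := Real.sqrt_pos.2 hm
  have h6 : 0 < √(1 + y ^ 2) := by positivity
  rw [show b * (-(1 / (2 * y ^ 2)) / (y ^ 2) ^ 2 / (2 * (√(1 - y ^ 2) / y)))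
    = -(b * ((1 / (2 * y ^ 2)) / (y ^ 2) ^ 2 / (2 * (√(1 - y ^ 2) / y)))) by ring, abs_neg,
    abs_of_pos (by positivity)]
  field_simp

/-- Equate the two evaluations of the integral; the reflection formula trades Γ(1/4) for Γ(3/4). -/
lemma thetaNull_one_sq : thetaNull 1 ^ 2 = √Real.pi / Real.Gamma (3 / 4) ^ 2 := by
  have hT := thetaNull_pos one_pos
  have h4 : 0 < thetaFour 1 := by simpa using thetaFour_two_pow_pos 0
  have hr := thetaRatio_one_pow
  rw [thetaRatio_one, div_pow, div_eq_iff (by positivity)] at hr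
  have h := integral_agmKernel_lemniscate (a := thetaNull 1 ^ 2) (b := thetaFour 1 ^ 2)
    (by positivity) (by linarith)
  have hG := Real.Gamma_mul_Gamma_one_sub (1 / 4)
  rw [show (1 - 1 / 4 : ℝ) = 3 / 4 by norm_num, show Real.pi * (1 / 4) = Real.pi / 4 by ring,
    Real.sin_pi_div_four] at hG
  have hp : 0 < Real.Gamma (3 / 4) := Real.Gamma_pos_of_pos (by norm_num)
  rw [integral_agmKernel_theta, Real.Gamma_one_half_eq, show (1 / 4 + 1 / 2 : ℝ) = 3 / 4 by norm_num]
    at h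
  have h2 : thetaNull 1 ^ 2 = √2 * thetaFour 1 ^ 2 := by
    rw [← sq_eq_sq₀ (by positivity) (by positivity), mul_pow, Real.sq_sqrt (by norm_num)]
    linarith
  have hs2 : √2 ^ 2 = (2 : ℝ) := Real.sq_sqrt (by norm_num)
  have hpi := Real.pi_pos
  rw [h2, eq_div_iff (by positivity)]
  have h3 : Real.Gamma (1 / 4) = Real.pi * √2 / Real.Gamma (3 / 4) := by
    rw [eq_div_iff hp.ne', hG]
    field_simp
    linarith
  rw [h3] at h
  field_simp at h
  have h5 : 2 * (thetaFour 1 ^ 2 * Real.Gamma (3 / 4) ^ 2) = √2 * √Real.pi := by linarith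
  linear_combination √2 / 2 * h5 + √Real.pi / 2 * hs2

lemma thetaNull_one : thetaNull 1 = Real.pi ^ (1 / 4 : ℝ) / Real.Gamma (3 / 4) := by
  have hp : 0 < Real.Gamma (3 / 4) := Real.Gamma_pos_of_pos (by norm_num)
  have hT := thetaNull_pos one_pos
  have hpi := Real.pi_pos
  rw [← sq_eq_sq₀ hT.le (by positivity), thetaNull_one_sq, div_pow, Real.sqrt_eq_rpow,
    ← Real.rpow_natCast (Real.pi ^ (1 / 4 : ℝ)), ← Real.rpow_mul hpi.le]
  norm_num

/-! ### Closed forms of the iterates -/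

lemma thetaRatio_four_pow_succ (n : ℕ) :
    thetaRatio (4 ^ (n + 1)) = (1 - (1 - thetaRatio (4 ^ n) ^ 4) ^ (1 / 4 : ℝ)) /
      (1 + (1 - thetaRatio (4 ^ n) ^ 4) ^ (1 / 4 : ℝ)) := by
  have h0 : (0 : ℝ) < 4 ^ n := by positivity
  have h1 := thetaRatio_pos (t := 4 ^ (n + 1)) (by positivity)
  have h2 : 0 ≤ thetaFour (4 ^ n) / thetaNull (4 ^ n) :=
    (div_pos (thetaFour_four_pow_pos n) (thetaNull_pos h0)).le
  have h3 : ((thetaFour (4 ^ n) / thetaNull (4 ^ n)) ^ 4) ^ (1 / 4 : ℝ)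
      = thetaFour (4 ^ n) / thetaNull (4 ^ n) := by
    rw [← Real.rpow_natCast, ← Real.rpow_mul h2]
    norm_num
  rw [one_sub_thetaRatio_pow h0, h3, thetaFour_div_thetaNull h0, ← pow_succ']
  have : 1 + thetaRatio (4 ^ (n + 1)) ≠ 0 := by positivity
  field_simp
  ring

lemma thetaRatio_one_eq : thetaRatio 1 = (2 : ℝ) ^ (-(1 / 4) : ℝ) := by
  rw [← pow_left_inj₀ (thetaRatio_pos one_pos).le (by positivity) four_ne_zero, thetaRatio_one_pow,
    ← Real.rpow_natCast, ← Real.rpow_mul (by norm_num)]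
  norm_num [Real.rpow_neg_one]

lemma one_add_thetaRatio_four_pow_succ (n : ℕ) :
    1 + thetaRatio (4 ^ (n + 1)) = thetaNull (4 ^ n) / thetaNull (4 ^ (n + 1)) := by
  rw [one_add_thetaRatio, pow_succ, mul_div_assoc, div_self four_ne_zero, mul_one]

lemma limit_eq_thetaNull_one (w : ℝ) :
    1 / (Real.Gamma (3 / 4) ^ (2 * w - 2) * Real.pi ^ (3 / 2 - w / 2))
      = thetaNull 1 ^ (2 * w - 2) / Real.pi := by
  have hp : 0 < Real.Gamma (3 / 4) := Real.Gamma_pos_of_pos (by norm_num)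
  have hpi := Real.pi_pos
  rw [thetaNull_one, Real.div_rpow (by positivity) hp.le, ← Real.rpow_mul hpi.le, div_div,
    div_eq_div_iff (by positivity) (by positivity), one_mul, mul_left_comm,
    ← Real.rpow_add hpi]
  rw [show 1 / 4 * (2 * w - 2) + (3 / 2 - w / 2) = 1 by ring, Real.rpow_one]

section iteration

variable {w : ℝ} {d c a : ℕ → ℝ}

lemma iteration_ratio (hd_zero : d 0 = (2 : ℝ) ^ (-(1 / 4) : ℝ))
    (hd : ∀ n, d (n + 1) =
      (1 - (1 - d n ^ 4) ^ (1 / 4 : ℝ)) / (1 + (1 - d n ^ 4) ^ (1 / 4 : ℝ))) (n : ℕ) :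
    d n = thetaRatio (4 ^ n) := by
  induction n with
  | zero => rw [hd_zero, pow_zero, thetaRatio_one_eq]
  | succ n ih => rw [hd, ih, thetaRatio_four_pow_succ]

lemma iteration_multiplier (hc_zero : c 0 = 2)
    (hc : ∀ n, c (n + 1) = 4 * c n * (1 + d (n + 1)) ^ (2 * w - 2))
    (hd : ∀ n, d n = thetaRatio (4 ^ n)) (n : ℕ) :
    c n = 2 * 4 ^ n * (thetaNull 1 / thetaNull (4 ^ n)) ^ (2 * w - 2) := by
  have hT : ∀ n : ℕ, 0 < thetaNull (4 ^ n) := fun n => thetaNull_pos (by positivity)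
  induction n with
  | zero => simp [hc_zero, (thetaNull_pos one_pos).ne']
  | succ n ih =>
    have h1 := thetaNull_pos one_pos
    rw [hc, ih, hd, one_add_thetaRatio_four_pow_succ,
      show thetaNull 1 / thetaNull (4 ^ (n + 1)) = thetaNull 1 / thetaNull (4 ^ n) *
        (thetaNull (4 ^ n) / thetaNull (4 ^ (n + 1))) from
        (div_mul_div_cancel₀ (hT n).ne').symm,
      Real.mul_rpow (div_pos h1 (hT n)).le (div_pos (hT n) (hT (n + 1))).le]
    ring

/-- Multiplying a n by θ(4^n)^(2w+2) leaves an additive recursion, whose increments are those of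
4·4^n (θ'/θ)(4^n) up to the factor L. -/
lemma iteration_value (ha_zero : a 0 = 0)
    (ha : ∀ n, a (n + 1) = a n * (1 + d (n + 1)) ^ (2 * w + 2)
      + 1 / 2 * c (n + 1) * (d (n + 1) / (1 + d (n + 1))) * (1 - d (n + 1) ^ 4))
    (hd : ∀ n, d n = thetaRatio (4 ^ n))
    (hc : ∀ n, c n = 2 * 4 ^ n * (thetaNull 1 / thetaNull (4 ^ n)) ^ (2 * w - 2)) (n : ℕ) :
    a n = thetaNull 1 ^ (2 * w - 2) / Real.pi * (1 + 4 * 4 ^ n * thetaNullLogDeriv (4 ^ n)) /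
      thetaNull (4 ^ n) ^ (2 * w + 2) := by
  have hT : ∀ n : ℕ, 0 < thetaNull (4 ^ n) := fun n => thetaNull_pos (by positivity)
  induction n with
  | zero => simp [ha_zero, thetaNullLogDeriv_one]
  | succ n ih =>
    have h1 := thetaNull_pos one_pos
    have hpi := Real.pi_pos
    have hl := thetaNullLogDeriv_sub n
    rw [ha, hc, ih, hd, one_add_thetaRatio_four_pow_succ] at *
    -- The exponents of the `a` and `c` recursions differ by 4, which supplies the θ⁴ of
    -- `thetaNullLogDeriv_sub`.
    have hS : thetaNull (4 ^ (n + 1)) ^ (2 * w - 2) =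
        thetaNull (4 ^ (n + 1)) ^ (2 * w + 2) / thetaNull (4 ^ (n + 1)) ^ 4 := by
      rw [← Real.rpow_natCast _ 4, ← Real.rpow_sub (hT (n + 1))]
      congr 1; push_cast; ring
    rw [Real.div_rpow (hT n).le (hT (n + 1)).le, Real.div_rpow h1.le (hT (n + 1)).le, hS]
    have hA := Real.rpow_pos_of_pos (hT n) (2 * w + 2)
    have hB := Real.rpow_pos_of_pos (hT (n + 1)) (2 * w + 2)
    have hC := Real.rpow_pos_of_pos h1 (2 * w - 2)
    have hT0 := hT n
    have hT1 := hT (n + 1)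
    generalize thetaNull (4 ^ n) ^ (2 * w + 2) = A at *
    generalize thetaNull (4 ^ (n + 1)) ^ (2 * w + 2) = B at *
    generalize thetaNull 1 ^ (2 * w - 2) = C at *
    have e : C / Real.pi * (1 + 4 * 4 ^ n * thetaNullLogDeriv (4 ^ n)) / A * (A / B) =
        C / Real.pi * (1 + 4 * 4 ^ n * thetaNullLogDeriv (4 ^ n)) / B := by field_simp
    rw [e, sub_eq_iff_eq_add.1 hl, pow_succ]
    field_simp
    ring

end iteration

/-! ### Error asymptotics and quartic convergence -/

lemma tendsto_four_pow : Tendsto (fun n : ℕ => (4 : ℝ) ^ n) atTop atTop :=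
  tendsto_pow_atTop_atTop_of_one_lt (by norm_num)

/-- The term 4tθ'/θ ~ -8πtq dominates; the denominator contributes only O(q), lost after division by
tq. -/
lemma tendsto_iteration_error (w : ℝ) :
    Tendsto (fun t : ℝ => (thetaNull 1 ^ (2 * w - 2) / Real.pi *
      (1 + 4 * t * thetaNullLogDeriv t) / thetaNull t ^ (2 * w + 2) -
      thetaNull 1 ^ (2 * w - 2) / Real.pi) / (t * Real.exp (-Real.pi * t))) atTop
      (𝓝 (-8 * thetaNull 1 ^ (2 * w - 2))) := by
  have hpow : Tendsto (fun t => thetaNull t ^ (2 * w + 2)) atTop (𝓝 1) := by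
    simpa using tendsto_thetaNull.rpow_const (p := 2 * w + 2) (Or.inl one_ne_zero)
  have hO : (fun t => thetaNull t ^ (2 * w + 2) - 1) =O[atTop]
      fun t => Real.exp (-Real.pi * t) := by
    have h1 := (Real.hasDerivAt_rpow_const (x := 1) (p := 2 * w + 2)
      (Or.inl one_ne_zero)).isBigO_sub.comp_tendsto tendsto_thetaNull
    simp only [Real.one_rpow] at h1
    exact h1.trans (isBigO_of_div_tendsto_nhds
      (Eventually.of_forall fun t h => absurd h (Real.exp_pos _).ne') _ tendsto_thetaNull_sub_one)
  have h0 : Tendsto (fun t => (thetaNull t ^ (2 * w + 2) - 1) / (t * Real.exp (-Real.pi * t)))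
      atTop (𝓝 0) := by
    refine IsLittleO.tendsto_div_nhds_zero (hO.trans_isLittleO ?_)
    have := (isLittleO_const_id_atTop (1 : ℝ)).mul_isBigO
      (isBigO_refl (fun t => Real.exp (-Real.pi * t)) atTop)
    simpa using this
  have h := (((tendsto_thetaNullLogDeriv.const_mul 4).sub h0).div hpow one_ne_zero).const_mul
    (thetaNull 1 ^ (2 * w - 2) / Real.pi)
  have hpi := Real.pi_pos
  rw [show thetaNull 1 ^ (2 * w - 2) / Real.pi * ((4 * (-2 * Real.pi) - 0) / 1) =
    -8 * thetaNull 1 ^ (2 * w - 2) by field_simp; ring] at h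
  refine Tendsto.congr' ?_ h
  filter_upwards [eventually_gt_atTop 0] with t ht
  have hA := Real.rpow_pos_of_pos (thetaNull_pos ht) (2 * w + 2)
  have hE := Real.exp_pos (-Real.pi * t)
  simp only [Pi.div_apply]
  generalize thetaNull t ^ (2 * w + 2) = A at *
  generalize Real.exp (-Real.pi * t) = E at *
  field_simp
  ring

/-- A nonzero `C` bounds the error on both sides by multiples of the model 4^n exp(-π 4^n), and
forces log|error|/4^n → -π, hence the ratio 4. -/
lemma convergesQuartically_of_tendsto_div {u : ℕ → ℝ} {L C : ℝ} (hC : C ≠ 0)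
    (h : Tendsto (fun n => (u n - L) / (4 ^ n * Real.exp (-Real.pi * 4 ^ n))) atTop (𝓝 C)) :
    ConvergesQuartically u L := by
  set g : ℕ → ℝ := fun n => 4 ^ n * Real.exp (-Real.pi * 4 ^ n) with hg
  have hg0 : ∀ n, 0 < g n := fun n => by positivity
  have hgt : Tendsto g atTop (𝓝 0) := by
    have h1 : Tendsto (fun x : ℝ => x * Real.exp (-Real.pi * x)) atTop (𝓝 0) := by
      simpa using tendsto_rpow_mul_exp_neg_mul_atTop_nhds_zero 1 Real.pi Real.pi_pos
    exact h1.comp tendsto_four_pow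
  have hΘ : (fun n => u n - L) =Θ[atTop] g := (isTheta_of_div_tendsto_nhds_ne_zero h hC).symm
  have hlog : Tendsto (fun n => Real.log |u n - L| / 4 ^ n) atTop (𝓝 (-Real.pi)) := by
    have h1 : Tendsto (fun n => Real.log |(u n - L) / g n| / 4 ^ n) atTop (𝓝 0) :=
      (h.abs.log (abs_ne_zero.2 hC)).div_atTop tendsto_four_pow
    have h2 : Tendsto (fun n : ℕ => (n : ℝ) / 4 ^ n) atTop (𝓝 0) := by
      simpa using tendsto_pow_const_div_const_pow_of_one_lt 1 (r := (4 : ℝ)) (by norm_num)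
    have h3 := (h1.add (h2.mul_const (Real.log 4))).add_const (-Real.pi)
    rw [zero_mul, add_zero, zero_add] at h3
    refine Tendsto.congr' ?_ h3
    filter_upwards [h.eventually_ne hC] with n hn
    have e1 : u n - L ≠ 0 := fun e => hn (by rw [e, zero_div])
    rw [abs_div, abs_of_pos (hg0 n), Real.log_div (abs_ne_zero.2 e1) (hg0 n).ne', hg,
      Real.log_mul (by positivity) (Real.exp_pos _).ne', Real.log_exp, Real.log_pow]
    field_simp
    ring
  refine ⟨?_, ?_, ?_⟩
  · have := hΘ.1.trans_tendsto hgt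
    simpa using this.add_const L
  · have h1 : (fun n => g (n + 1)) =O[atTop] fun n => g n ^ 4 := by
      refine IsBigO.of_bound 4 (Eventually.of_forall fun n => ?_)
      -- The exponentials match exactly in the fourth power; the powers of 4 only help.
      have e : g (n + 1) * (4 ^ n) ^ 3 = 4 * g n ^ 4 := by
        simp only [hg]
        rw [mul_pow, ← Real.exp_nat_mul, pow_succ (4 : ℝ) n]
        push_cast
        rw [show 4 * (-Real.pi * 4 ^ n) = -Real.pi * (4 ^ n * 4) by ring]
        ring
      rw [Real.norm_of_nonneg (hg0 _).le, Real.norm_of_nonneg (pow_pos (hg0 _) 4).le, ← e]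
      exact le_mul_of_one_le_right (hg0 _).le (one_le_pow₀ (one_le_pow₀ (by norm_num)))
    exact ((hΘ.1.comp_tendsto (tendsto_add_atTop_nat 1)).trans h1).trans (hΘ.2.pow 4)
  · have h1 := ((hlog.comp (tendsto_add_atTop_nat 1)).div hlog
      (neg_ne_zero.2 Real.pi_ne_zero)).const_mul 4
    rw [div_self (neg_ne_zero.2 Real.pi_ne_zero), mul_one] at h1
    refine h1.congr fun n => ?_
    simp only [Pi.div_apply, Function.comp, pow_succ]
    field_simp

theorem mainTheorem3 (w : ℝ) (d c a : ℕ → ℝ)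
    (hd_zero : d 0 = (2 : ℝ) ^ (-(1 / 4) : ℝ)) (hc_zero : c 0 = 2) (ha_zero : a 0 = 0)
    (hd : ∀ n, d (n + 1) =
      (1 - (1 - d n ^ 4) ^ (1 / 4 : ℝ)) / (1 + (1 - d n ^ 4) ^ (1 / 4 : ℝ)))
    (hc : ∀ n, c (n + 1) = 4 * c n * (1 + d (n + 1)) ^ (2 * w - 2))
    (ha : ∀ n, a (n + 1) = a n * (1 + d (n + 1)) ^ (2 * w + 2)
      + 1 / 2 * c (n + 1) * (d (n + 1) / (1 + d (n + 1))) * (1 - d (n + 1) ^ 4)) :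
    ConvergesQuartically a
      (1 / (Real.Gamma (3 / 4) ^ (2 * w - 2) * Real.pi ^ (3 / 2 - w / 2))) := by
  have h1 := iteration_ratio hd_zero hd
  have h2 := iteration_multiplier hc_zero hc h1
  have h3 := iteration_value ha_zero ha h1 h2
  rw [limit_eq_thetaNull_one]
  refine convergesQuartically_of_tendsto_div (C := -8 * thetaNull 1 ^ (2 * w - 2))
    (mul_ne_zero (by norm_num) (Real.rpow_pos_of_pos (thetaNull_pos one_pos) _).ne') ?_
  refine ((tendsto_iteration_error w).comp tendsto_four_pow).congr fun n => ?_
  rw [h3 n, Function.comp]
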